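/- For natural numbers \(k,n,m\), the conditional restricted Boltzmann machine \(\mathrm{RBM}^k_{n,m}\) with \(k\) input, \(n\) output and \(m\) hidden units is the set of all conditional distributions \(p(y|x)\) of \(y\in\{0,1\}^n\) given \(x\in\{0,1\}^k\) of the form \[p(y|x)=\frac{1}{Z(x)}\sum_{z\in\{0,1\}^m}\exp\bigl(z^\top Vx+z^\top Wy+b^\top y+c^\top z\bigr)\quad\text{for all }x,y,\] where \(V\in\mathbb R^{m\times k}\), \(W\in\mathbb R^{m\times n}\), \(b\in\mathbb R^n\), \(c\in\mathbb R^m\), and \(Z(x)\) normalizes over \(y\). We say that it is a universal approximator if for every conditional distribution \(q\) of \(y\in\{0,1\}^n\) given \(x\in\{0,1\}^k\) and every \(\varepsilon>0\) there is \(p\in\mathrm{RBM}^k_{n,m}\) with \(\sum_y|p(y|x)-q(y|x)|\le\varepsilon\) for all \(x\). For \(r\ge1\) let \(S(r)=1+2+\cdots+r\) (and \(S(0)=0\)), let \(F(1)=1\) and \(F(r)=2^{S(r-1)}+(2^r-(r+1))F(r-1)\) for \(r\ge2\), and let \(R(r)=\prod_{i=2}^r(2^i-(i+1))\), \(K(r)=2^{-S(r)}F(r)\),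 and \(P(r)=\frac12\prod_{i=2}^r\bigl(1-\frac{i+1}{2^i}\bigr)\) (so \(R(r)=2^{S(r)}P(r)\)). Theorem. \(\mathrm{RBM}^k_{n,m}\) is a universal approximator in each of the following cases: \(k\ge1\) and \(m\ge\frac12 2^k(2^n-1)\); \(k\ge3\) and \(m\ge\frac38 2^k(2^n-1)+1\); \(k\ge21\) and \(m\ge\frac14 2^k\bigl(2^n-1+\frac1{30}\bigr)\). More generally, it is a universal approximator whenever, for some integer \(r\ge1\) with \(S(r)\le k\), \[m\ge 2^kK(r)(2^n-1)+2^{S(r)}P(r)=2^{k-S(r)}F(r)(2^n-1)+R(r).\] Moreover, \(K(r)\) and \(P(r)\) converge as \(r\to\infty\), and their limits are approximately \(0.2263\) and \(0.0269\), respectively (each within \(5\cdot10^{-5}\)). -/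

import Mathlib

open Filter Topology
open scoped Matrix

noncomputable section

namespace CRBM

/-- The set `{0,1}^d` of binary states of `d` units. -/
abbrev Cube (d : ℕ) : Type := Fin d → Bool

/-- A binary state regarded as a real column vector with entries `0` and `1`. -/
def vec {d : ℕ} (x : Cube d) : Fin d → ℝ := fun i => if x i then 1 else 0

/-- The conditional distributions of `y ∈ {0,1}^n` given `x ∈ {0,1}^k`: row-stochastic matrices,
with one row in the probability simplex on `{0,1}^n` for every `x`. -/
def condDist (k n : ℕ) : Set (Cube k → Cube n → ℝ) :=
  {p | ∀ x, p x ∈ stdSimplex ℝ (Cube n)}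

/-- The weight `∑_z exp(zᵀ V x + zᵀ W y + bᵀ y + cᵀ z)`. -/
def weight {k n m : ℕ} (V : Matrix (Fin m) (Fin k) ℝ) (W : Matrix (Fin m) (Fin n) ℝ)
    (b : Fin n → ℝ) (c : Fin m → ℝ) (x : Cube k) (y : Cube n) : ℝ :=
  ∑ z : Cube m, Real.exp
    (vec z ⬝ᵥ (V *ᵥ vec x) + vec z ⬝ᵥ (W *ᵥ vec y) + b ⬝ᵥ vec y + c ⬝ᵥ vec z)

/-- The normalization function, for the input `x`. -/
def normalization {k n m : ℕ} (V : Matrix (Fin m) (Fin k) ℝ) (W : Matrix (Fin m) (Fin n) ℝ)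
    (b : Fin n → ℝ) (c : Fin m → ℝ) (x : Cube k) : ℝ :=
  ∑ y : Cube n, weight V W b c x y

/-- The conditional restricted Boltzmann machine with `k` input units, `n` output units and
`m` hidden units. -/
def model (k n m : ℕ) : Set (Cube k → Cube n → ℝ) :=
  {p | p ∈ condDist k n ∧
    ∃ (V : Matrix (Fin m) (Fin k) ℝ) (W : Matrix (Fin m) (Fin n) ℝ)
      (b : Fin n → ℝ) (c : Fin m → ℝ),
      ∀ x y, p x y = 1 / normalization V W b c x * weight V W b c x y}

/-- The model with `k` inputs, `n` outputs and `m` hidden units approximates every conditional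
distribution arbitrarily well. -/
def IsUniversalApproximator (k n m : ℕ) : Prop :=
  ∀ q ∈ condDist k n, ∀ ε : ℝ, 0 < ε →
    ∃ p ∈ model k n m, ∀ x, ∑ y, |p x y - q x y| ≤ ε

/-- `S(r) = 1 + 2 + ⋯ + r`. -/
def S (r : ℕ) : ℕ := ∑ i ∈ Finset.Icc 1 r, i

/-- `f_i(z) = 2^{S(i-1)} + (2^i - (i+1)) z`, for `i ≥ 1`. -/
def f (i : ℕ) (z : ℝ) : ℝ := 2 ^ S (i - 1) + (2 ^ i - ((i : ℝ) + 1)) * z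

/-- `F(r) = f_r(f_{r-1}(⋯ f_2(f_1)))`, for `r ≥ 1`; note that `f_1` is the constant `1`, so that
the value at `0` plays no role. -/
def F : ℕ → ℝ
  | 0 => 0
  | r + 1 => f (r + 1) (F r)

/-- `K(r) = 2^{-S(r)} F(r)`. -/
def K (r : ℕ) : ℝ := F r / 2 ^ S r

/-- `R(r) = ∏_{i=2}^r (2^i - (i+1))`. -/
def R (r : ℕ) : ℝ := ∏ i ∈ Finset.Icc 2 r, ((2 : ℝ) ^ i - ((i : ℝ) + 1))

/-- `P(r) = 1/2 ∏_{i=2}^r (1 - (i+1)/2^i)`; thus `R(r) = 2^{S(r)} P(r)` for `r ≥ 1`. -/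
def P (r : ℕ) : ℝ := 1 / 2 * ∏ i ∈ Finset.Icc 2 r, (1 - ((i : ℝ) + 1) / 2 ^ i)

end CRBM

end

/-! Up to a factor that depends only on `x`, the weight of a conditional restricted Boltzmann machine
is `exp (b ⬝ᵥ y)` times a product over the hidden units of factors `1 + exp (affine in (x, y))`
(`weight_eq_prod`). At a large scale `t`, a hidden unit can therefore act at a single output state
`y`, and multiply its weight by an arbitrary amount for all inputs in a set on which an affine
function of `x` is positive, leaving the other inputs alone where the function is negative.

The output bias makes the origin the dominant output state. A few hidden units, the gates, raise the
weight of the origin further, by `exp (t * height x)`, where the height is a sum of positive parts of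
affine functions of `x`. Suppose the inputs are partitioned into affinely independent cells such
that, for every cell, some affine function agrees with the height on the cell and is negative
elsewhere (`AffineCover`). Then one hidden unit per cell and output state `y ≠ 0` suffices to make
`y` as probable relative to the origin as desired for all inputs in the cell: the affine function
compensates the height, a bounded affine correction sets the exact ratios, and there is no effect
outside of the cell (`tendsto_scaledWeight_of_ne`). So `|J| + |I| (2 ^ n - 1)` hidden units are
enough for a cover with gates `J` and cells `I` (`isUniversalApproximator_of_cover`).

Such covers are built block by block. A cube of positive dimension splits into parallel edges, with
no gates. Given a cover of `κ`-inputs, a block of `r` further inputs is added at the cost of one gate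
`2 B (3 / 2 - number of ones)`, with `B` above the old height: the stars consisting of the states of
the block with at most one `1` become new cells, and the old cells are used over the remaining
`2 ^ r - (r + 1)` states of the block (`AffineCover.addBlock`). With blocks of sizes `1, 2, …, r` and
`d` further inputs this gives `2 ^ d * F r` cells and `r - 1 ≤ R r` gates (`exists_cover`). The
gates play the role of the `R r` additional hidden units in the bound; fewer of them are needed.

The limits of `K` and `P` are bracketed by monotonicity: both sequences decrease from some point on,
by at most `(r + 2) / 2 ^ (r + 1)` in each step (`exists_tendsto_of_step`). -/

namespace CRBM

/-! ### Affine functions on cubes -/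

/-- A real function on the cube `ι → Bool` is affine if it is the restriction of an affine function
on `ι → ℝ`, where `false` and `true` stand for `0` and `1`. -/
def IsAffine {ι : Type} [Fintype ι] (g : (ι → Bool) → ℝ) : Prop :=
  ∃ (a : ι → ℝ) (c : ℝ), ∀ x, g x = (∑ i, a i * if x i then 1 else 0) + c

namespace IsAffine

variable {ι κ : Type} [Fintype ι] [Fintype κ]

lemma const (c : ℝ) : IsAffine (fun _ : ι → Bool => c) :=
  ⟨0, c, fun x => by simp⟩

lemma add {g h : (ι → Bool) → ℝ} (hg : IsAffine g) (hh : IsAffine h) :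
    IsAffine (fun x => g x + h x) := by
  obtain ⟨a, c, hg⟩ := hg
  obtain ⟨b, d, hh⟩ := hh
  refine ⟨fun i => a i + b i, c + d, fun x => ?_⟩
  simp only [hg, hh, add_mul, Finset.sum_add_distrib]
  ring

lemma const_mul {g : (ι → Bool) → ℝ} (s : ℝ) (hg : IsAffine g) :
    IsAffine (fun x => s * g x) := by
  obtain ⟨a, c, hg⟩ := hg
  refine ⟨fun i => s * a i, s * c, fun x => ?_⟩
  simp only [hg, mul_add, Finset.mul_sum, mul_assoc]

lemma sub {g h : (ι → Bool) → ℝ} (hg : IsAffine g) (hh : IsAffine h) :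
    IsAffine (fun x => g x - h x) := by
  have := hg.add (hh.const_mul (-1))
  simpa [sub_eq_add_neg] using this

lemma comp_inl {g : (ι → Bool) → ℝ} (hg : IsAffine g) :
    IsAffine (fun x : ι ⊕ κ → Bool => g (x ∘ Sum.inl)) := by
  obtain ⟨a, c, hg⟩ := hg
  exact ⟨Sum.elim a 0, c, fun x => by simp [hg]⟩

lemma comp_inr {g : (κ → Bool) → ℝ} (hg : IsAffine g) :
    IsAffine (fun x : ι ⊕ κ → Bool => g (x ∘ Sum.inr)) := by
  obtain ⟨a, c, hg⟩ := hg
  exact ⟨Sum.elim 0 a, c, fun x => by simp [hg]⟩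

lemma comp_equiv {g : (ι → Bool) → ℝ} (hg : IsAffine g) (e : ι ≃ κ) :
    IsAffine (fun x : κ → Bool => g (x ∘ e)) := by
  obtain ⟨a, c, hg⟩ := hg
  refine ⟨a ∘ e.symm, c, fun x => ?_⟩
  simp only [hg, ← e.sum_comp (fun i => (a ∘ e.symm) i * if x i then (1 : ℝ) else 0)]
  simp

lemma hammingDist (y : ι → Bool) :
    IsAffine (fun x => (_root_.hammingDist x y : ℝ)) := by
  refine ⟨fun i => if y i then -1 else 1, ∑ i, if y i then 1 else 0, fun x => ?_⟩
  simp only [_root_.hammingDist, Finset.card_filter, Nat.cast_sum]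
  rw [← Finset.sum_add_distrib]
  refine Finset.sum_congr rfl fun i _ => ?_
  cases x i <;> cases y i <;> simp

end IsAffine

lemma one_le_hammingDist {ι : Type} [Fintype ι] {x y : ι → Bool} (h : x ≠ y) :
    (1 : ℝ) ≤ hammingDist x y := by
  exact_mod_cast Nat.one_le_iff_ne_zero.mpr (hammingDist_ne_zero.mpr h)

/-! ### Stars -/

/-- The Hamming distance of `u` to the origin, that is, the number of ones of `u`. -/
def ones {r : ℕ} (u : Cube r) : ℕ := hammingDist u fun _ => false

/-- The vertices of the star centred at the origin: the origin, indexed by `none`, and its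
neighbours. -/
def starVertex {r : ℕ} : Option (Fin r) → Cube r
  | none => fun _ => false
  | some i => fun j => decide (j = i)

lemma starVertex_injective {r : ℕ} : Function.Injective (starVertex (r := r)) := by
  rintro (_ | i) (_ | j) h
  · rfl
  · simpa [starVertex] using congrFun h j
  · simpa [starVertex] using congrFun h i
  · simpa [starVertex] using congrFun h i

lemma ones_starVertex_none {r : ℕ} : ones (starVertex (r := r) none) = 0 := by
  simp [ones, starVertex]

lemma ones_starVertex_some {r : ℕ} (i : Fin r) : ones (starVertex (some i)) = 1 := by
  simp [ones, starVertex, hammingDist, Finset.filter_eq']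

lemma ones_le_one_iff {r : ℕ} {u : Cube r} : ones u ≤ 1 ↔ ∃ o, starVertex o = u := by
  constructor
  · intro h
    rcases Nat.le_one_iff_eq_zero_or_eq_one.mp h with h | h
    · exact ⟨none, (hammingDist_eq_zero.mp h).symm⟩
    · obtain ⟨i, hi⟩ := Finset.card_eq_one.mp (show Finset.card {i | u i ≠ false} = 1 from h)
      refine ⟨some i, funext fun j => ?_⟩
      have := Finset.ext_iff.mp hi j
      by_cases hj : j = i
      · simpa [starVertex, hj] using this
      · simpa [starVertex, hj] using this
  · rintro ⟨_ | i, rfl⟩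
    · simp [ones_starVertex_none]
    · simp [ones_starVertex_some]

lemma card_two_le_ones (r : ℕ) :
    (Fintype.card {u : Cube r // ¬ ones u ≤ 1} : ℝ) = 2 ^ r - ((r : ℝ) + 1) := by
  have h1 : Fintype.card {u : Cube r // ones u ≤ 1} = r + 1 := by
    rw [← Fintype.card_fin r, ← Fintype.card_option, Fintype.card_fin]
    refine (Fintype.card_of_bijective (f := fun o : Option (Fin r) =>
      (⟨starVertex o, ones_le_one_iff.mpr ⟨o, rfl⟩⟩ : {u : Cube r // ones u ≤ 1})) ⟨?_, ?_⟩).symm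
    · exact fun o p h => starVertex_injective (Subtype.ext_iff.mp h)
    · rintro ⟨u, hu⟩
      obtain ⟨o, rfl⟩ := ones_le_one_iff.mp hu
      exact ⟨o, rfl⟩
  have h2 := Fintype.card_subtype_compl (fun u : Cube r => ones u ≤ 1)
  have h3 : Fintype.card {u : Cube r // ones u ≤ 1} ≤ Fintype.card (Cube r) :=
    Fintype.card_subtype_le _
  rw [h2, Nat.cast_sub h3, h1]
  simp

/-- The vertices of a star are affinely independent: every function on the star extends to an
affine function. -/
lemma exists_isAffine_eq_on_star {r : ℕ} (g : Cube r → ℝ) :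
    ∃ G : Cube r → ℝ, IsAffine G ∧ ∀ u, ones u ≤ 1 → G u = g u := by
  refine ⟨_, ⟨fun i => g (starVertex (some i)) - g (starVertex none), g (starVertex none),
    fun u => rfl⟩, fun u hu => ?_⟩
  obtain ⟨_ | i, rfl⟩ := ones_le_one_iff.mp hu
  · simp [starVertex]
  · have h : ∀ j, starVertex (some i) j = decide (j = i) := fun _ => rfl
    simp [h]

/-! ### Affine covers -/

/-- Combinatorial data from which a universal approximator with `|J| + |I| (2^n - 1)` hidden units
is built. The gates, indexed by `J`, are affine functions on the input cube; the sum of their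
positive parts is the height. The cells, indexed by `I`, form a partition of the input cube into
affinely independent sets, encoded by the map `cell` that sends an input to the index of its cell.
For every cell there is an affine function that agrees with the height on the cell and is negative
on all other inputs. -/
structure AffineCover (ι J I : Type) [Fintype ι] [Fintype J] where
  /-- The affine functions whose positive parts add up to the height. -/
  gate : J → (ι → Bool) → ℝ
  /-- The cell that contains a given input. -/
  cell : (ι → Bool) → I
  /-- The affine function singling out a cell. -/
  support : I → (ι → Bool) → ℝ
  gate_isAffine : ∀ j, IsAffine (gate j)
  gate_ne_zero : ∀ j x, gate j x ≠ 0
  support_isAffine : ∀ i, IsAffine (support i)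
  support_eq : ∀ x, support (cell x) x = ∑ j, max (gate j x) 0
  support_neg : ∀ i x, cell x ≠ i → support i x < 0
  exists_extension : ∀ i (g : (ι → Bool) → ℝ), ∃ G, IsAffine G ∧ ∀ x, cell x = i → G x = g x

namespace AffineCover

variable {ι κ J I : Type} [Fintype ι] [Fintype κ] [Fintype J]

/-- The sum of the positive parts of the gates. -/
def height (A : AffineCover ι J I) (x : ι → Bool) : ℝ := ∑ j, max (A.gate j x) 0

lemma height_nonneg (A : AffineCover ι J I) (x : ι → Bool) : 0 ≤ A.height x :=
  Finset.sum_nonneg fun _ _ => le_max_right _ _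

lemma support_le_height (A : AffineCover ι J I) (i : I) (x : ι → Bool) :
    A.support i x ≤ A.height x := by
  by_cases h : A.cell x = i
  · subst h
    exact (A.support_eq x).le
  · exact (A.support_neg i x h).le.trans (A.height_nonneg x)

lemma exists_height_lt (A : AffineCover ι J I) : ∃ B, 0 < B ∧ ∀ x, A.height x < B := by
  classical
  refine ⟨∑ x, A.height x + 1, ?_, fun x => ?_⟩
  · have := Finset.sum_nonneg fun x (_ : x ∈ Finset.univ) => A.height_nonneg x
    linarith
  · have := Finset.single_le_sum (fun x _ => A.height_nonneg x) (Finset.mem_univ x)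
    linarith

/-- Transport of a cover along a relabelling of the input units. -/
def reindex (A : AffineCover ι J I) (e : ι ≃ κ) : AffineCover κ J I where
  gate j x := A.gate j (x ∘ e)
  cell x := A.cell (x ∘ e)
  support i x := A.support i (x ∘ e)
  gate_isAffine j := (A.gate_isAffine j).comp_equiv e
  gate_ne_zero j x := A.gate_ne_zero j _
  support_isAffine i := (A.support_isAffine i).comp_equiv e
  support_eq x := A.support_eq _
  support_neg i x h := A.support_neg i _ h
  exists_extension i g := by
    obtain ⟨G, hG, h⟩ := A.exists_extension i fun x => g (x ∘ e.symm)
    refine ⟨_, hG.comp_equiv e, fun x hx => ?_⟩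
    rw [h _ hx]
    congr 1
    ext
    simp

/-- Superfluous gates that are negative on all inputs do not change the height. -/
def pad (A : AffineCover ι J I) (J' : Type) [Fintype J'] : AffineCover ι (J ⊕ J') I where
  gate := Sum.elim A.gate fun _ _ => -1
  cell := A.cell
  support := A.support
  gate_isAffine := by
    rintro (j | j)
    · exact A.gate_isAffine j
    · exact .const _
  gate_ne_zero := by
    rintro (j | j) x
    · exact A.gate_ne_zero j x
    · simp
  support_isAffine := A.support_isAffine
  support_eq x := by simp [A.support_eq]
  support_neg := A.support_neg
  exists_extension := A.exists_extension

/-- The partition of a cube of positive dimension into parallel edges. No gates are needed, because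
the edges are faces of the cube. -/
def edges (κ : Type) [Fintype κ] : AffineCover (Fin 1 ⊕ κ) Empty (κ → Bool) where
  gate j := j.elim
  cell x := x ∘ Sum.inr
  support v x := -1 * (hammingDist (x ∘ Sum.inr) v : ℝ)
  gate_isAffine j := j.elim
  gate_ne_zero j := j.elim
  support_isAffine v := ((IsAffine.hammingDist v).const_mul (-1)).comp_inr
  support_eq x := by simp
  support_neg v x h := by
    have := one_le_hammingDist h
    linarith
  exists_extension v g := by
    obtain ⟨G, hG, h⟩ := exists_isAffine_eq_on_star (r := 1) fun u => g (Sum.elim u v)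
    refine ⟨_, hG.comp_inl, fun x hx => ?_⟩
    rw [h _ ?_, ← hx, Sum.elim_comp_inl_inr]
    simpa [ones] using hammingDist_le_card_fintype (x := x ∘ Sum.inl) (y := fun _ : Fin 1 => false)

open Classical in
/-- Given a cover for the inputs in `κ`, add a block of `r` inputs `u`. Over every `v` there is one
new cell, the star of all `(u, v)` where `u` has at most one `1`; over every other `u` the old cells
are used. The new gate, which decreases steeply in the number of ones of `u`, makes the affine
extension of the height from a star to the rest of its face negative. -/
noncomputable def addBlock (A : AffineCover κ J I) (r : ℕ) :
    AffineCover (Fin r ⊕ κ) (Option J) ((κ → Bool) ⊕ {u : Cube r // ¬ ones u ≤ 1} × I) :=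
  let B := A.exists_height_lt.choose
  have hB0 : 0 < B := A.exists_height_lt.choose_spec.1
  have hB : ∀ v, A.height v < B := A.exists_height_lt.choose_spec.2
  { gate := fun j x => j.elim (2 * B * (3 / 2 - (ones (x ∘ Sum.inl) : ℝ)))
      fun j => A.gate j (x ∘ Sum.inr)
    cell := fun x =>
      if h : ones (x ∘ Sum.inl) ≤ 1 then .inl (x ∘ Sum.inr)
      else .inr (⟨x ∘ Sum.inl, h⟩, A.cell (x ∘ Sum.inr))
    support := Sum.elim
      (fun v x => (A.height v + 2 * B * (3 / 2 - (ones (x ∘ Sum.inl) : ℝ)))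
        - 4 * B * hammingDist (x ∘ Sum.inr) v)
      (fun p x => A.support p.2 (x ∘ Sum.inr) - 4 * B * hammingDist (x ∘ Sum.inl) p.1.1)
    gate_isAffine := by
      rintro (_ | j)
      · exact (((IsAffine.const _).sub (.hammingDist _)).const_mul _).comp_inl
      · exact (A.gate_isAffine j).comp_inr
    gate_ne_zero := by
      rintro (_ | j) x
      · refine mul_ne_zero (by positivity) fun h => ?_
        have h : ((3 : ℕ) : ℝ) = ((2 * ones (x ∘ Sum.inl) : ℕ) : ℝ) := by
          push_cast
          linarith [show (3 / 2 - (ones (x ∘ Sum.inl) : ℝ)) = 0 from h]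
        have := Nat.cast_injective h
        omega
      · exact A.gate_ne_zero j _
    support_isAffine := by
      rintro (v | p)
      · exact ((IsAffine.const _).add
          (((IsAffine.const _).sub (.hammingDist _)).const_mul _).comp_inl).sub
            ((IsAffine.hammingDist v).comp_inr.const_mul _)
      · exact (A.support_isAffine _).comp_inr.sub ((IsAffine.hammingDist p.1.1).comp_inl.const_mul _)
    support_eq := by
      intro x
      by_cases h : ones (x ∘ Sum.inl) ≤ 1
      · have h' : (ones (x ∘ Sum.inl) : ℝ) ≤ 1 := by exact_mod_cast h
        have : 0 ≤ 2 * B * (3 / 2 - (ones (x ∘ Sum.inl) : ℝ)) :=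
          mul_nonneg (by positivity) (by linarith)
        simp only [h, dif_pos, Sum.elim_inl, hammingDist_self, Fintype.sum_option, Option.elim]
        rw [max_eq_left this]
        simp [height, add_comm]
      · have h' : (2 : ℝ) ≤ ones (x ∘ Sum.inl) := by exact_mod_cast not_le.mp h
        have : 2 * B * (3 / 2 - (ones (x ∘ Sum.inl) : ℝ)) ≤ 0 :=
          mul_nonpos_of_nonneg_of_nonpos (by positivity) (by linarith)
        simp only [h, Sum.elim_inr, hammingDist_self, Fintype.sum_option, Option.elim,
          dif_neg, not_false_eq_true]
        rw [max_eq_right this]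
        simp [A.support_eq]
    support_neg := by
      rintro (v | ⟨u, i⟩) x hx
      · simp only [Sum.elim_inl]
        have h1 := hB v
        by_cases h : ones (x ∘ Sum.inl) ≤ 1
        · have hv : x ∘ Sum.inr ≠ v := fun hv => hx (by rw [dif_pos h, hv])
          have h2 := one_le_hammingDist hv
          have h3 : (0 : ℝ) ≤ ones (x ∘ Sum.inl) := Nat.cast_nonneg _
          nlinarith
        · have h' : (2 : ℝ) ≤ ones (x ∘ Sum.inl) := by exact_mod_cast not_le.mp h
          have h2 : (0 : ℝ) ≤ hammingDist (x ∘ Sum.inr) v := Nat.cast_nonneg _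
          nlinarith
      · simp only [Sum.elim_inr]
        by_cases hu : x ∘ Sum.inl = u.1
        · have hi : A.cell (x ∘ Sum.inr) ≠ i := by
            intro hi
            have hu' : ¬ ones (x ∘ Sum.inl) ≤ 1 := hu ▸ u.2
            refine hx ?_
            rw [dif_neg hu', hi]
            congr 2
            exact Subtype.ext hu
          simpa [hu] using A.support_neg i _ hi
        · have h1 := one_le_hammingDist hu
          have h2 := A.support_le_height i (x ∘ Sum.inr)
          have h3 := hB (x ∘ Sum.inr)
          nlinarith
    exists_extension := by
      rintro (v | ⟨u, i⟩) g
      · obtain ⟨G, hG, h⟩ := exists_isAffine_eq_on_star (r := r) fun u => g (Sum.elim u v)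
        refine ⟨_, hG.comp_inl, fun x hx => ?_⟩
        by_cases hu : ones (x ∘ Sum.inl) ≤ 1
        · rw [dif_pos hu, Sum.inl.injEq] at hx
          rw [h _ hu, ← hx, Sum.elim_comp_inl_inr]
        · simp [dif_neg hu] at hx
      · obtain ⟨G, hG, h⟩ := A.exists_extension i fun v => g (Sum.elim u.1 v)
        refine ⟨_, hG.comp_inr, fun x hx => ?_⟩
        by_cases hu : ones (x ∘ Sum.inl) ≤ 1
        · simp [dif_pos hu] at hx
        · rw [dif_neg hu, Sum.inr.injEq, Prod.mk.injEq] at hx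
          rw [h _ hx.2, ← hx.1, Sum.elim_comp_inl_inr] }

end AffineCover

/-! ### The weight as a product over the hidden units -/

lemma weight_eq_prod {k n m : ℕ} (V : Matrix (Fin m) (Fin k) ℝ) (W : Matrix (Fin m) (Fin n) ℝ)
    (b : Fin n → ℝ) (c : Fin m → ℝ) (x : Cube k) (y : Cube n) :
    weight V W b c x y = Real.exp (b ⬝ᵥ vec y) *
      ∏ j, (1 + Real.exp ((V *ᵥ vec x) j + (W *ᵥ vec y) j + c j)) := by
  have h : ∀ j, 1 + Real.exp ((V *ᵥ vec x) j + (W *ᵥ vec y) j + c j) = ∑ s : Bool,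
      Real.exp ((if s then 1 else 0) * ((V *ᵥ vec x) j + (W *ᵥ vec y) j + c j)) := fun j => by
    simp [add_comm]
  simp only [h]
  rw [Finset.prod_univ_sum, Fintype.piFinset_univ, Finset.mul_sum]
  refine Finset.sum_congr rfl fun z _ => ?_
  rw [← Real.exp_sum, ← Real.exp_add, dotProduct_comm c]
  congr 1
  simp only [dotProduct, vec, mul_add, Finset.sum_add_distrib]
  ring

/-- Hidden units whose inputs are arbitrary affine functions of `x` and `y` can be realized. The
weight is only determined up to a constant factor `s`, because the bias of the output units has no
constant term. -/
lemma exists_weight_eq {k n m : ℕ} {H : Type} [Fintype H] (hm : Fintype.card H = m)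
    {α : H → Cube k → ℝ} {γ : H → Cube n → ℝ} {β : Cube n → ℝ}
    (hα : ∀ j, IsAffine (α j)) (hγ : ∀ j, IsAffine (γ j)) (hβ : IsAffine β) :
    ∃ (V : Matrix (Fin m) (Fin k) ℝ) (W : Matrix (Fin m) (Fin n) ℝ)
      (b : Fin n → ℝ) (c : Fin m → ℝ) (s : ℝ), 0 < s ∧ ∀ x y, weight V W b c x y =
        s * (Real.exp (β y) * ∏ j, (1 + Real.exp (α j x + γ j y))) := by
  choose v cv hv using hα
  choose w cw hw using hγ
  obtain ⟨b, cb, hb⟩ := hβ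
  let e := Fintype.equivFinOfCardEq hm
  refine ⟨.of fun j => v (e.symm j), .of fun j => w (e.symm j), b,
    fun j => cv (e.symm j) + cw (e.symm j), Real.exp (-cb), Real.exp_pos _, fun x y => ?_⟩
  rw [weight_eq_prod, ← mul_assoc, ← Real.exp_add, hb, ← e.symm.prod_comp]
  congr 1
  · simp [dotProduct, vec]
  · refine Finset.prod_congr rfl fun j _ => ?_
    simp only [hv, hw, Matrix.mulVec, dotProduct, vec, Matrix.of_apply]
    ring_nf

/-- A conditional distribution is determined by its weight up to factors that depend only on the
input. -/
lemma div_sum_mem_model {k n m : ℕ} {V : Matrix (Fin m) (Fin k) ℝ} {W : Matrix (Fin m) (Fin n) ℝ}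
    {b : Fin n → ℝ} {c : Fin m → ℝ} {s : Cube k → ℝ} {w : Cube k → Cube n → ℝ}
    (hs : ∀ x, 0 < s x) (hw : ∀ x y, 0 < w x y)
    (h : ∀ x y, weight V W b c x y = s x * w x y) :
    (fun x y => w x y / ∑ y', w x y') ∈ model k n m := by
  have hsum : ∀ x, 0 < ∑ y, w x y := fun x =>
    Finset.sum_pos (fun y _ => hw x y) Finset.univ_nonempty
  refine ⟨fun x => ⟨fun y => (div_pos (hw x y) (hsum x)).le, ?_⟩, V, W, b, c, fun x y => ?_⟩
  · rw [← Finset.sum_div, div_self (hsum x).ne']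
  · rw [normalization]
    simp only [h]
    rw [← Finset.mul_sum]
    have := (hs x).ne'
    have := (hsum x).ne'
    field_simp

/-! ### Limits of single factors -/

lemma tendsto_one_add_exp {a : ℝ} (ha : a < 0) (g : ℝ) :
    Tendsto (fun t : ℝ => 1 + Real.exp (t * a + g)) atTop (𝓝 1) := by
  have h : Tendsto (fun t : ℝ => t * a + g) atTop atBot :=
    tendsto_atBot_add_const_right _ _ (tendsto_id.atTop_mul_const_of_neg ha)
  simpa using (Real.tendsto_exp_atBot.comp h).const_add 1

lemma tendsto_exp_mul_one_add_exp {a : ℝ} (ha : 0 < a) (g : ℝ) :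
    Tendsto (fun t : ℝ => Real.exp (-(t * a)) * (1 + Real.exp (t * a + g))) atTop
      (𝓝 (Real.exp g)) := by
  have h : Tendsto (fun t : ℝ => -(t * a)) atTop atBot :=
    tendsto_neg_atTop_atBot.comp (tendsto_id.atTop_mul_const ha)
  have h' := (Real.tendsto_exp_atBot.comp h).add_const (Real.exp g)
  rw [zero_add] at h'
  refine h'.congr fun t => ?_
  rw [mul_add, mul_one, ← Real.exp_add, neg_add_cancel_left, Function.comp]

lemma tendsto_exp_max_mul_one_add_exp {a : ℝ} (ha : a ≠ 0) :
    Tendsto (fun t : ℝ => Real.exp (-(t * max a 0)) * (1 + Real.exp (t * a))) atTop (𝓝 1) := by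
  rcases ha.lt_or_gt with ha | ha
  · simpa [max_eq_right ha.le] using tendsto_one_add_exp ha 0
  · simpa [max_eq_left ha.le] using tendsto_exp_mul_one_add_exp ha 0

/-! ### Approximation with an affine cover -/

/-- The output state with all units off. It is the reference state: the weights of all other
output states are adjusted relative to it. -/
def origin (n : ℕ) : Cube n := fun _ => false

/-- The hidden units built from a cover: one for each gate, and one for each cell and each output
state other than the origin. -/
abbrev Hidden (J I : Type) (n : ℕ) : Type := J ⊕ I × {y : Cube n // y ≠ origin n}

section limit

variable {k n : ℕ} {J I : Type} [Fintype J]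

/-- The summand of the total input of a hidden unit that depends on the input `x`, at scale `t`.
The constant `B` controls the bias of the output units. The unit of a cell `i` and an output state
`y` has the additional term `G i y`, which sets the exact ratio of the probabilities of `y` and
the origin for the inputs in the cell. -/
def inputPart (A : AffineCover (Fin k) J I) (B : ℝ)
    (G : I → {y : Cube n // y ≠ origin n} → Cube k → ℝ) (t : ℝ) :
    Hidden J I n → Cube k → ℝ
  | .inl j, x => t * A.gate j x
  | .inr (i, y), x => t * (A.support i x + B * hammingDist y.1 (origin n)) + G i y x

/-- The summand of the total input of a hidden unit that depends on the output `y`, at scale `t`.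
For large `C` it makes the unit negligible except at a single output state. -/
def outputPart (J I : Type) {n : ℕ} (C t : ℝ) : Hidden J I n → Cube n → ℝ
  | .inl _, y => t * (-C * hammingDist y (origin n))
  | .inr (_, y'), y => t * (-C * hammingDist y y'.1)

lemma inputPart_isAffine (A : AffineCover (Fin k) J I) (B : ℝ)
    {G : I → {y : Cube n // y ≠ origin n} → Cube k → ℝ} (hG : ∀ i y, IsAffine (G i y)) (t : ℝ)
    (j : Hidden J I n) : IsAffine (inputPart A B G t j) := by
  rcases j with j | ⟨i, y⟩
  · exact (A.gate_isAffine j).const_mul t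
  · exact (((A.support_isAffine i).add (.const _)).const_mul t).add (hG i y)

lemma outputPart_isAffine {J I : Type} {n : ℕ} (C t : ℝ) (j : Hidden J I n) :
    IsAffine (outputPart J I C t j) := by
  rcases j with j | ⟨i, y⟩
  · exact ((IsAffine.hammingDist (origin n)).const_mul (-C)).const_mul t
  · exact ((IsAffine.hammingDist y.1).const_mul (-C)).const_mul t

/-- The weight at scale `t`, normalized by a factor that depends only on the input, such that it
tends to `1` at the origin. -/
noncomputable def scaledWeight [Fintype I] (A : AffineCover (Fin k) J I) (B C : ℝ)
    (G : I → {y : Cube n // y ≠ origin n} → Cube k → ℝ) (t : ℝ) (x : Cube k) (y : Cube n) : ℝ :=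
  Real.exp (-(t * A.height x)) * (Real.exp (-(t * B) * hammingDist y (origin n)) *
    ∏ j : Hidden J I n, (1 + Real.exp (inputPart A B G t j x + outputPart J I C t j y)))

lemma scaledWeight_pos [Fintype I] (A : AffineCover (Fin k) J I) (B C : ℝ)
    (G : I → {y : Cube n // y ≠ origin n} → Cube k → ℝ) (t : ℝ) (x : Cube k) (y : Cube n) :
    0 < scaledWeight A B C G t x y := by
  have : 0 < ∏ j : Hidden J I n,
      (1 + Real.exp (inputPart A B G t j x + outputPart J I C t j y)) :=
    Finset.prod_pos fun j _ => by positivity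
  unfold scaledWeight
  positivity

variable (A : AffineCover (Fin k) J I) {B C : ℝ}

/-- At output states other than its own, the unit of a cell is negligible. -/
lemma tendsto_factor_of_ne (hC0 : 0 ≤ C)
    (hC : ∀ i x (y : Cube n), A.support i x + B * hammingDist y (origin n) < C)
    (G : I → {y : Cube n // y ≠ origin n} → Cube k → ℝ) (x : Cube k) {y : Cube n}
    {p : I × {y : Cube n // y ≠ origin n}} (hp : y ≠ p.2.1) :
    Tendsto (fun t => 1 + Real.exp (inputPart A B G t (.inr p) x + outputPart J I C t (.inr p) y))
      atTop (𝓝 1) := by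
  have h1 := one_le_hammingDist hp
  have h2 := hC p.1 x p.2.1
  have h3 := le_mul_of_one_le_right hC0 h1
  refine (tendsto_one_add_exp (a := A.support p.1 x + B * hammingDist p.2.1 (origin n)
    - C * hammingDist y p.2.1) (by linarith) (G p.1 p.2 x)).congr fun t => ?_
  simp only [inputPart, outputPart]
  congr 2
  ring

lemma tendsto_scaledWeight_origin [Fintype I] (hC0 : 0 ≤ C)
    (hC : ∀ i x (y : Cube n), A.support i x + B * hammingDist y (origin n) < C)
    (G : I → {y : Cube n // y ≠ origin n} → Cube k → ℝ) (x : Cube k) :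
    Tendsto (fun t => scaledWeight A B C G t x (origin n)) atTop (𝓝 1) := by
  have h1 := tendsto_finsetProd Finset.univ fun (j : J) _ =>
    tendsto_exp_max_mul_one_add_exp (A.gate_ne_zero j x)
  have h2 := tendsto_finsetProd Finset.univ
    fun (p : I × {y : Cube n // y ≠ origin n}) _ =>
      tendsto_factor_of_ne A hC0 hC G x (p := p) p.2.2.symm
  have h := h1.mul h2
  simp only [Finset.prod_const_one, mul_one] at h
  refine h.congr fun t => ?_
  rw [scaledWeight, Fintype.prod_sum_type, Finset.prod_mul_distrib, ← Real.exp_sum,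
    Finset.sum_neg_distrib, ← Finset.mul_sum, hammingDist_self]
  simp [inputPart, outputPart, AffineCover.height, mul_assoc]

lemma tendsto_scaledWeight_of_ne [Fintype I] (hB0 : 0 < B)
    (hB : ∀ i x (y : Cube n), A.cell x ≠ i → A.support i x + B * hammingDist y (origin n) < 0)
    (hC0 : 0 ≤ C)
    (hC : ∀ i x (y : Cube n), A.support i x + B * hammingDist y (origin n) < C)
    (hC' : ∀ j x, A.gate j x < C)
    (G : I → {y : Cube n // y ≠ origin n} → Cube k → ℝ) (x : Cube k)
    (y : {y : Cube n // y ≠ origin n}) :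
    Tendsto (fun t => scaledWeight A B C G t x y) atTop
      (𝓝 (Real.exp (G (A.cell x) y x))) := by
  classical
  have hy := one_le_hammingDist y.2
  have h1 := tendsto_finsetProd Finset.univ fun (j : J) _ =>
    tendsto_one_add_exp (a := A.gate j x - C * hammingDist y.1 (origin n))
      (by linarith [hC' j x, le_mul_of_one_le_right hC0 hy]) 0
  -- The normalizing factor is absorbed into the unit of `y` and the cell of `x`.
  have h2 := tendsto_finsetProd Finset.univ
    fun (p : I × {y : Cube n // y ≠ origin n}) _ => show Tendsto (fun t =>
        (if p = (A.cell x, y) then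
          Real.exp (-(t * (A.height x + B * hammingDist y.1 (origin n)))) else 1) *
        (1 + Real.exp (inputPart A B G t (.inr p) x + outputPart J I C t (.inr p) y)))
        atTop (𝓝 (if p = (A.cell x, y) then Real.exp (G p.1 p.2 x) else 1)) from by
      by_cases hp : p = (A.cell x, y)
      · subst hp
        simp only [if_true]
        have hpos : 0 < A.height x + B * hammingDist y.1 (origin n) := by
          have := A.height_nonneg x
          positivity
        refine (tendsto_exp_mul_one_add_exp hpos (G (A.cell x) y x)).congr fun t => ?_
        simp [inputPart, outputPart, A.support_eq, AffineCover.height]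
      · simp only [hp, if_false, one_mul]
        by_cases hpy : y.1 = p.2.1
        · have hpx : A.cell x ≠ p.1 := fun h => hp (Prod.ext h.symm (Subtype.ext hpy.symm))
          refine (tendsto_one_add_exp (hB p.1 x p.2.1 hpx) (G p.1 p.2 x)).congr fun t => ?_
          simp [inputPart, outputPart, hpy]
        · exact tendsto_factor_of_ne A hC0 hC G x hpy
  have h := h1.mul h2
  rw [Finset.prod_const_one, one_mul, Finset.prod_ite_eq' Finset.univ (A.cell x, y)
    (fun p => Real.exp (G p.1 p.2 x)), if_pos (Finset.mem_univ _)] at h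
  refine h.congr fun t => ?_
  rw [Finset.prod_mul_distrib, Finset.prod_ite_eq', if_pos (Finset.mem_univ _), scaledWeight,
    Fintype.prod_sum_type, ← mul_assoc (Real.exp (-(t * A.height x))), ← Real.exp_add]
  have e1 : -(t * A.height x) + -(t * B) * (hammingDist y.1 (origin n) : ℝ)
      = -(t * (A.height x + B * hammingDist y.1 (origin n))) := by ring
  have e2 : ∀ j, inputPart A B G t (.inl j) x + outputPart J I C t (.inl j) y.1
      = t * (A.gate j x - C * hammingDist y.1 (origin n)) + 0 := fun j => by
    simp only [inputPart, outputPart]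
    ring
  simp only [e1, e2]
  ring

/-- A bias `B` that is small compared to the values of the affine functions of the cells outside
of the cells. -/
lemma exists_bias [Finite I] : ∃ B, 0 < B ∧
    ∀ i x (y : Cube n), A.cell x ≠ i → A.support i x + B * hammingDist y (origin n) < 0 := by
  have h : ∀ᶠ B : ℝ in 𝓝[>] 0, ∀ i x (y : Cube n), A.cell x ≠ i →
      A.support i x + B * hammingDist y (origin n) < 0 := by
    simp only [eventually_all]
    intro i x y hx
    have : Tendsto (fun B : ℝ => A.support i x + B * hammingDist y (origin n)) (𝓝[>] 0)
        (𝓝 (A.support i x + 0 * hammingDist y (origin n))) :=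
      ((tendsto_id.mul_const _).const_add _).mono_left nhdsWithin_le_nhds
    refine this.eventually_lt_const ?_
    simpa using A.support_neg i x hx
  exact (eventually_mem_nhdsWithin.and h).exists

lemma exists_penalty [Finite I] (B : ℝ) : ∃ C, 0 ≤ C ∧
    (∀ i x (y : Cube n), A.support i x + B * hammingDist y (origin n) < C) ∧
    ∀ j x, A.gate j x < C := by
  have h : ∀ᶠ C : ℝ in atTop,
      (∀ i x (y : Cube n), A.support i x + B * hammingDist y (origin n) < C) ∧
      ∀ j x, A.gate j x < C := by
    refine .and ?_ ?_ <;> simp only [eventually_all] <;> intros <;> exact eventually_gt_atTop _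
  exact ((eventually_ge_atTop 0).and h).exists

end limit

lemma exists_mem_model_of_pos {k n m : ℕ} {J I : Type} [Fintype J] [Fintype I]
    (A : AffineCover (Fin k) J I) (hm : Fintype.card (Hidden J I n) = m)
    {q : Cube k → Cube n → ℝ} (hq : q ∈ condDist k n) (hpos : ∀ x y, 0 < q x y)
    {ε : ℝ} (hε : 0 < ε) : ∃ p ∈ model k n m, ∀ x, ∑ y, |p x y - q x y| ≤ ε := by
  obtain ⟨B, hB0, hB⟩ := exists_bias (n := n) A
  obtain ⟨C, hC0, hC, hC'⟩ := exists_penalty (n := n) A B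
  choose G hG hGq using fun i (y : {y : Cube n // y ≠ origin n}) =>
    A.exists_extension i fun x => Real.log (q x y / q x (origin n))
  have lim : ∀ x y, Tendsto (fun t => scaledWeight A B C G t x y) atTop
      (𝓝 (q x y / q x (origin n))) := by
    intro x y
    by_cases hy : y = origin n
    · subst hy
      rw [div_self (hpos _ _).ne']
      exact tendsto_scaledWeight_origin A hC0 hC G x
    · have := tendsto_scaledWeight_of_ne A hB0 hB hC0 hC hC' G x ⟨y, hy⟩
      rwa [hGq _ _ _ rfl, Real.exp_log (div_pos (hpos _ _) (hpos _ _))] at this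
  have lim' : ∀ x, Tendsto (fun t => ∑ y, |scaledWeight A B C G t x y /
      ∑ y', scaledWeight A B C G t x y' - q x y|) atTop (𝓝 0) := by
    intro x
    have hsum : ∑ y, q x y / q x (origin n) = 1 / q x (origin n) := by
      rw [← Finset.sum_div, (hq x).2]
    have h0 := (hpos x (origin n)).ne'
    have h1 := tendsto_finsetSum Finset.univ fun y (_ : y ∈ Finset.univ) => lim x y
    rw [hsum] at h1
    have h2 := tendsto_finsetSum Finset.univ fun y (_ : y ∈ Finset.univ) =>
      (((lim x y).div h1 (by positivity)).sub_const (q x y)).abs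
    refine h2.congr' (.of_eq rfl) |>.trans (le_of_eq ?_)
    congr 1
    refine Finset.sum_eq_zero fun y _ => ?_
    rw [div_div_div_cancel_right₀ h0, div_one, sub_self, abs_zero]
  obtain ⟨t, ht⟩ := (eventually_all.mpr fun x => (lim' x).eventually_le_const hε).exists
  obtain ⟨V, W, b, c, s, hs, hw⟩ := exists_weight_eq hm (inputPart_isAffine A B hG t)
    (outputPart_isAffine C t) ((IsAffine.hammingDist (origin n)).const_mul (-(t * B)))
  refine ⟨_, div_sum_mem_model (V := V) (W := W) (b := b) (c := c)
    (s := fun x => s * Real.exp (t * A.height x)) (fun x => by positivity)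
    (scaledWeight_pos A B C G t) fun x y => ?_, ht⟩
  rw [hw, scaledWeight, mul_assoc s, ← mul_assoc (Real.exp (t * A.height x)), ← Real.exp_add,
    add_neg_cancel, Real.exp_zero, one_mul]

/-- Mixing with the uniform distribution gives strictly positive approximations. -/
lemma exists_pos_approx {k n : ℕ} {q : Cube k → Cube n → ℝ} (hq : q ∈ condDist k n)
    {ε : ℝ} (hε : 0 < ε) :
    ∃ q' ∈ condDist k n, (∀ x y, 0 < q' x y) ∧ ∀ x, ∑ y, |q' x y - q x y| ≤ ε := by
  set η : ℝ := min 1 (ε / 2)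
  have h0 : 0 < η := lt_min one_pos (by positivity)
  have h1 : η ≤ 1 := min_le_left _ _
  have h2 : η ≤ ε / 2 := min_le_right _ _
  have hN : (0 : ℝ) < Fintype.card (Cube n) := by exact_mod_cast Fintype.card_pos
  have hsum : ∑ _y : Cube n, 1 / (Fintype.card (Cube n) : ℝ) = 1 := by
    rw [Finset.sum_const, Finset.card_univ, nsmul_eq_mul, mul_one_div_cancel hN.ne']
  have hpos : ∀ x y, 0 < (1 - η) * q x y + η * (1 / Fintype.card (Cube n)) := fun x y => by
    have := mul_nonneg (sub_nonneg.mpr h1) ((hq x).1 y)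
    positivity
  refine ⟨fun x y => (1 - η) * q x y + η * (1 / Fintype.card (Cube n)),
    fun x => ⟨fun y => (hpos x y).le, ?_⟩, hpos, fun x => ?_⟩
  · rw [Finset.sum_add_distrib, ← Finset.mul_sum, ← Finset.mul_sum, hsum, (hq x).2]
    ring
  · calc _ ≤ ∑ y, η * (1 / Fintype.card (Cube n) + q x y) := by
          refine Finset.sum_le_sum fun y _ => ?_
          have e : (1 - η) * q x y + η * (1 / Fintype.card (Cube n)) - q x y
              = η * (1 / Fintype.card (Cube n) - q x y) := by ring
          have hy := (hq x).1 y
          have hN' : 0 < 1 / (Fintype.card (Cube n) : ℝ) := by positivity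
          rw [e, abs_mul, abs_of_pos h0]
          refine mul_le_mul_of_nonneg_left (abs_le.mpr ⟨?_, ?_⟩) h0.le <;> linarith
      _ = η * 2 := by
          rw [← Finset.mul_sum, Finset.sum_add_distrib, hsum, (hq x).2]
          norm_num
      _ ≤ ε := by linarith

theorem isUniversalApproximator_of_cover {k n m : ℕ} {J I : Type} [Fintype J] [Fintype I]
    (A : AffineCover (Fin k) J I) (hm : Fintype.card J + Fintype.card I * (2 ^ n - 1) ≤ m) :
    IsUniversalApproximator k n m := by
  intro q hq ε hε
  obtain ⟨q', hq', hpos, h1⟩ := exists_pos_approx hq (half_pos hε)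
  -- Superfluous hidden units become gates without effect.
  have hcard : Fintype.card
      (Hidden (J ⊕ Fin (m - (Fintype.card J + Fintype.card I * (2 ^ n - 1)))) I n) = m := by
    have : Fintype.card {y : Cube n // y ≠ origin n} = 2 ^ n - 1 := by
      rw [Fintype.card_subtype_compl, Fintype.card_subtype_eq]
      simp
    simp only [Fintype.card_sum, Fintype.card_prod, Fintype.card_fin, this]
    omega
  obtain ⟨p, hp, h2⟩ := exists_mem_model_of_pos (A.pad _) hcard hq' hpos (half_pos hε)
  refine ⟨p, hp, fun x => ?_⟩
  calc ∑ y, |p x y - q x y| ≤ ∑ y, (|p x y - q' x y| + |q' x y - q x y|) :=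
        Finset.sum_le_sum fun y _ => abs_sub_le _ _ _
    _ ≤ ε := by
        rw [Finset.sum_add_distrib]
        linarith [h1 x, h2 x]

/-! ### The limits of `K` and `P` -/

lemma S_succ (r : ℕ) : S (r + 1) = S r + (r + 1) := by
  simp [S, Finset.sum_Icc_succ_top]

lemma K_succ (r : ℕ) : K (r + 1) = 1 / 2 ^ (r + 1) + (1 - ((r : ℝ) + 2) / 2 ^ (r + 1)) * K r := by
  simp only [K, F, f, S_succ, Nat.add_sub_cancel, pow_add (2 : ℝ) (S r)]
  push_cast
  field_simp
  ring

lemma P_succ {r : ℕ} (hr : 1 ≤ r) : P (r + 1) = (1 - ((r : ℝ) + 2) / 2 ^ (r + 1)) * P r := by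
  simp only [P]
  rw [Finset.prod_Icc_succ_top (by omega)]
  push_cast
  ring

lemma P_one : P 1 = 1 / 2 := by simp [P]

lemma add_two_le_two_pow (r : ℕ) : r + 2 ≤ 2 ^ (r + 1) := by
  have := Nat.lt_two_pow_self (n := r + 1)
  omega

/-- A sequence that decreases by at most `(r + 2) / 2 ^ (r + 1)` in each step converges, and the
distance of its limit to the value at `N` is at most `∑_{r ≥ N} (r + 2) / 2 ^ (r + 1)`. -/
lemma exists_tendsto_of_step {u : ℕ → ℝ} (N : ℕ)
    (h1 : ∀ r, N ≤ r → u (r + 1) ≤ u r)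
    (h2 : ∀ r, N ≤ r → u r - ((r : ℝ) + 2) / 2 ^ (r + 1) ≤ u (r + 1)) :
    ∃ l, Tendsto u atTop (𝓝 l) ∧ l ≤ u N ∧ u N - ((N : ℝ) + 3) / 2 ^ N ≤ l := by
  have anti : Antitone fun j => u (N + j) :=
    antitone_nat_of_succ_le fun j => h1 (N + j) (Nat.le_add_right _ _)
  have mono : Monotone fun j => u (N + j) - (((N + j : ℕ) : ℝ) + 3) / 2 ^ (N + j) := by
    refine monotone_nat_of_le_succ fun j => ?_
    have h := h2 (N + j) (Nat.le_add_right _ _)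
    have : (((N + j : ℕ) : ℝ) + 3) / 2 ^ (N + j)
        = (((N + j : ℕ) : ℝ) + 2) / 2 ^ (N + j + 1)
          + (((N + j + 1 : ℕ) : ℝ) + 3) / 2 ^ (N + j + 1) := by
      rw [pow_succ]
      push_cast
      field_simp
      ring
    have e : N + (j + 1) = N + j + 1 := by ring
    rw [e, this]
    linarith
  have bound : ∀ j, u N - ((N : ℝ) + 3) / 2 ^ N ≤ u (N + j) := fun j => by
    have h := mono (Nat.zero_le j)
    simp only [Nat.add_zero] at h
    have : 0 ≤ (((N + j : ℕ) : ℝ) + 3) / 2 ^ (N + j) := by positivity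
    linarith
  have lim := tendsto_atTop_ciInf anti ⟨_, by rintro _ ⟨j, rfl⟩; exact bound j⟩
  refine ⟨⨅ j, u (N + j), ?_, ?_, ?_⟩
  · rw [← tendsto_add_atTop_iff_nat N]
    simpa only [add_comm] using lim
  · exact le_of_tendsto' lim fun j => anti (Nat.zero_le j)
  · exact ge_of_tendsto' lim bound

lemma P_mem (r : ℕ) (hr : 1 ≤ r) : 0 ≤ P r ∧ P r ≤ 1 := by
  induction r, hr using Nat.le_induction with
  | base => rw [P_one]; norm_num
  | succ r hr ih =>
    rw [P_succ hr]
    have h : ((r : ℝ) + 2) / 2 ^ (r + 1) ≤ 1 :=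
      div_le_one_of_le₀ (by exact_mod_cast add_two_le_two_pow r) (by positivity)
    have h' : 0 ≤ ((r : ℝ) + 2) / 2 ^ (r + 1) := by positivity
    exact ⟨mul_nonneg (by linarith) ih.1, mul_le_one₀ (by linarith) ih.1 ih.2⟩

/-- The bounds `1 / (r + 2) ≤ K r ≤ 1` make `K` decreasing with small steps. -/
lemma K_mem (r : ℕ) (hr : 1 ≤ r) : 1 ≤ ((r : ℝ) + 2) * K r ∧ K r ≤ 1 := by
  induction r, hr using Nat.le_induction with
  | base => norm_num [K, F, f, S]
  | succ r hr ih =>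
    rw [K_succ]
    have h : ((r : ℝ) + 2) / 2 ^ (r + 1) ≤ 1 :=
      div_le_one_of_le₀ (by exact_mod_cast add_two_le_two_pow r) (by positivity)
    have e : ∀ z : ℝ, ((r : ℝ) + 2) / 2 ^ (r + 1) * z = (((r : ℝ) + 2) * z) * (1 / 2 ^ (r + 1)) :=
      fun z => by ring
    have h0 : (0 : ℝ) < 1 / 2 ^ (r + 1) := by positivity
    have h2 : (0 : ℝ) ≤ r := Nat.cast_nonneg r
    constructor
    · have h1 : 1 / ((r : ℝ) + 2) ≤ K r := by
        rw [div_le_iff₀ (by positivity)]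
        linarith [ih.1]
      have h3 : 1 / ((r : ℝ) + 2) ≤
          1 / 2 ^ (r + 1) + (1 - ((r : ℝ) + 2) / 2 ^ (r + 1)) * K r := by
        have := mul_le_mul_of_nonneg_left h1 (sub_nonneg.mpr h)
        refine le_trans (le_of_eq ?_) (add_le_add_right this _)
        field_simp
        ring
      have h4 : ((r : ℝ) + 2) * (1 / ((r : ℝ) + 2)) = 1 := by field_simp
      push_cast
      have h5 := mul_le_mul_of_nonneg_left h3 (by positivity : 0 ≤ (r : ℝ) + 1 + 2)
      refine le_trans ?_ h5
      rw [mul_one_div, le_div_iff₀ (by positivity)]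
      linarith
    · rw [sub_mul, one_mul, e]
      nlinarith [mul_le_mul_of_nonneg_right ih.1 h0.le]

theorem tendsto_K : ∃ κ : ℝ, Tendsto K atTop (𝓝 κ) ∧ |κ - 0.2263| ≤ 0.00005 := by
  have e : ∀ (r : ℕ) (z : ℝ), ((r : ℝ) + 2) / 2 ^ (r + 1) * z
      = (((r : ℝ) + 2) * z) * (1 / 2 ^ (r + 1)) := fun r z => by ring
  -- The error `27 / 2 ^ 24` is below `2e-6`; it has to be small because `0.2263` and `0.0269` are
  -- rounded, the latter by about `3.5e-5`.
  obtain ⟨l, hl, h1, h2⟩ := exists_tendsto_of_step (u := K) 24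
    (fun r hr => by
      have h := K_mem r (by omega)
      have h0 : (0 : ℝ) < 1 / 2 ^ (r + 1) := by positivity
      rw [K_succ, sub_mul, one_mul, e]
      linarith [mul_le_mul_of_nonneg_right h.1 h0.le])
    (fun r hr => by
      have h := K_mem r (by omega)
      have h0 : (0 : ℝ) < 1 / 2 ^ (r + 1) := by positivity
      have h1 : (0 : ℝ) ≤ ((r : ℝ) + 2) / 2 ^ (r + 1) := by positivity
      rw [K_succ, sub_mul, one_mul]
      linarith [mul_le_mul_of_nonneg_left h.2 h1])
  refine ⟨l, hl, ?_⟩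
  have hK : |K 24 - 0.226303| ≤ 0.000001 := by
    -- The recursion for `K` also holds from the junk value at `0`.
    have : K 0 = 0 := by simp [K, F]
    norm_num [K_succ, this, abs_le]
  rw [abs_le] at hK ⊢
  norm_num at h2 hK ⊢
  constructor <;> linarith

theorem tendsto_P : ∃ π : ℝ, Tendsto P atTop (𝓝 π) ∧ |π - 0.0269| ≤ 0.00005 := by
  obtain ⟨l, hl, h1, h2⟩ := exists_tendsto_of_step (u := P) 24
    (fun r hr => by
      have h := P_mem r (by omega)
      have h1 : (0 : ℝ) ≤ ((r : ℝ) + 2) / 2 ^ (r + 1) := by positivity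
      rw [P_succ (by omega), sub_mul, one_mul]
      linarith [mul_nonneg h1 h.1])
    (fun r hr => by
      have h := P_mem r (by omega)
      have h1 : (0 : ℝ) ≤ ((r : ℝ) + 2) / 2 ^ (r + 1) := by positivity
      rw [P_succ (by omega), sub_mul, one_mul]
      linarith [mul_le_mul_of_nonneg_left h.2 h1])
  refine ⟨l, hl, ?_⟩
  have hP : |P 24 - 0.026935| ≤ 0.000001 := by
    norm_num [P, Finset.prod_Icc_succ_top, abs_le]
  rw [abs_le] at hP ⊢
  norm_num at h2 hP ⊢
  constructor <;> linarith

/-! ### Counting cells and gates -/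

/-- The cover by stars in blocks of `r + 1, r, …, 2` inputs and edges in a last block, with `d`
inputs outside of all blocks. -/
lemma exists_cover (r d : ℕ) : ∃ (J I : Type) (_ : Fintype J) (_ : Fintype I),
    Fintype.card J = r ∧ (Fintype.card I : ℝ) = F (r + 1) * 2 ^ d ∧
      Nonempty (AffineCover (Fin (S (r + 1) + d)) J I) := by
  classical
  induction r with
  | zero =>
    refine ⟨Empty, Cube d, inferInstance, inferInstance, rfl, ?_,
      ⟨(AffineCover.edges (Fin d)).reindex (finSumFinEquiv.trans (finCongr ?_))⟩⟩
    · simp [F, f, S]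
    · simp [S]
  | succ r ih =>
    obtain ⟨J, I, _, _, hJ, hI, ⟨A⟩⟩ := ih
    refine ⟨Option J, (Cube (S (r + 1) + d)) ⊕ {u : Cube (r + 2) // ¬ ones u ≤ 1} × I,
      inferInstance, inferInstance, by simp [hJ], ?_,
      ⟨(A.addBlock (r + 2)).reindex (finSumFinEquiv.trans (finCongr ?_))⟩⟩
    · rw [Fintype.card_sum, Fintype.card_prod, Nat.cast_add, Nat.cast_mul, card_two_le_ones, hI,
        show F (r + 1 + 1) = f (r + 1 + 1) (F (r + 1)) from rfl, f, Nat.add_sub_cancel]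
      simp only [Fintype.card_pi, Fintype.card_bool, Finset.prod_const, Finset.card_univ,
        Fintype.card_fin, pow_add]
      push_cast
      ring
    · rw [S_succ (r + 1)]
      ring

lemma le_R_succ (r : ℕ) : (r : ℝ) ≤ R (r + 1) := by
  induction r with
  | zero => simp [R]
  | succ r ih =>
    have e : R (r + 1 + 1) = R (r + 1) * (2 ^ (r + 1 + 1) - (((r + 1 + 1 : ℕ) : ℝ) + 1)) := by
      rw [R, Finset.prod_Icc_succ_top (by omega), R]
    rw [e]
    rcases Nat.eq_zero_or_pos r with rfl | hr
    · norm_num [R]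
    · have h : (r : ℝ) + 2 ≤ 2 ^ (r + 1) := by exact_mod_cast add_two_le_two_pow r
      have hr' : (1 : ℝ) ≤ r := by exact_mod_cast hr
      rw [pow_succ]
      push_cast
      nlinarith

lemma two_pow_mul_P {r : ℕ} (hr : 1 ≤ r) : 2 ^ S r * P r = R r := by
  induction r, hr using Nat.le_induction with
  | base => norm_num [S, P, R]
  | succ r hr ih =>
    have e : R (r + 1) = R r * (2 ^ (r + 1) - ((r : ℝ) + 2)) := by
      rw [R, Finset.prod_Icc_succ_top (by omega), R]
      push_cast
      ring
    rw [e, ← ih, P_succ hr, S_succ, pow_add]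
    field_simp

/-- The number of gates in the cover is only `r - 1`. -/
theorem isUniversalApproximator_of_le {k n m r : ℕ} (hr : 1 ≤ r) (hk : S r ≤ k)
    (hm : (2 : ℝ) ^ (k - S r) * F r * (2 ^ n - 1) + ((r : ℝ) - 1) ≤ m) :
    IsUniversalApproximator k n m := by
  obtain ⟨r, rfl⟩ := Nat.exists_eq_add_of_le' hr
  obtain ⟨d, rfl⟩ := Nat.exists_eq_add_of_le hk
  obtain ⟨J, I, _, _, hJ, hI, ⟨A⟩⟩ := exists_cover r d
  refine isUniversalApproximator_of_cover A ?_
  rw [← Nat.cast_le (α := ℝ)]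
  push_cast [Nat.one_le_two_pow]
  rw [hI, hJ]
  rw [Nat.add_sub_cancel_left] at hm
  push_cast at hm
  linarith

end CRBM

theorem theorem2 :
    (∀ k n m : ℕ,
      (1 ≤ k → (1 / 2 : ℝ) * 2 ^ k * (2 ^ n - 1) ≤ m →
        CRBM.IsUniversalApproximator k n m) ∧
      (3 ≤ k → (3 / 8 : ℝ) * 2 ^ k * (2 ^ n - 1) + 1 ≤ m →
        CRBM.IsUniversalApproximator k n m) ∧
      (21 ≤ k → (1 / 4 : ℝ) * 2 ^ k * (2 ^ n - 1 + 1 / 30) ≤ m →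
        CRBM.IsUniversalApproximator k n m) ∧
      (∀ r : ℕ, 1 ≤ r → CRBM.S r ≤ k →
        (2 : ℝ) ^ k * CRBM.K r * (2 ^ n - 1) + 2 ^ CRBM.S r * CRBM.P r ≤ m →
        CRBM.IsUniversalApproximator k n m) ∧
      (∀ r : ℕ, 1 ≤ r → CRBM.S r ≤ k →
        (2 : ℝ) ^ (k - CRBM.S r) * CRBM.F r * (2 ^ n - 1) + CRBM.R r ≤ m →
        CRBM.IsUniversalApproximator k n m)) ∧
    (∃ κ : ℝ, Tendsto CRBM.K atTop (𝓝 κ) ∧ |κ - 0.2263| ≤ 0.00005) ∧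
    (∃ π : ℝ, Tendsto CRBM.P atTop (𝓝 π) ∧ |π - 0.0269| ≤ 0.00005) := by
  refine ⟨fun k n m => ?_, CRBM.tendsto_K, CRBM.tendsto_P⟩
  have general : ∀ r : ℕ, 1 ≤ r → CRBM.S r ≤ k →
      (2 : ℝ) ^ (k - CRBM.S r) * CRBM.F r * (2 ^ n - 1) + CRBM.R r ≤ m →
      CRBM.IsUniversalApproximator k n m := fun r hr hk hm => by
    refine CRBM.isUniversalApproximator_of_le hr hk (le_trans ?_ hm)
    obtain ⟨r, rfl⟩ := Nat.exists_eq_add_of_le' hr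
    have := CRBM.le_R_succ r
    push_cast
    linarith
  have hS : CRBM.S 1 = 1 ∧ CRBM.S 2 = 3 ∧ CRBM.S 6 = 21 := by decide
  obtain ⟨h1, h2, h6⟩ := hS
  refine ⟨fun hk hm => ?_, fun hk hm => ?_, fun hk hm => ?_, fun r hr hk hm => ?_, general⟩
  · refine CRBM.isUniversalApproximator_of_le (r := 1) le_rfl (h1 ▸ hk) (le_trans ?_ hm)
    obtain ⟨d, rfl⟩ := Nat.exists_eq_add_of_le hk
    rw [h1, Nat.add_sub_cancel_left]
    norm_num [CRBM.F, CRBM.f, CRBM.S, pow_add]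
    apply le_of_eq
    ring
  · refine CRBM.isUniversalApproximator_of_le (r := 2) (by omega) (h2 ▸ hk) (le_trans ?_ hm)
    obtain ⟨d, rfl⟩ := Nat.exists_eq_add_of_le hk
    rw [h2, Nat.add_sub_cancel_left]
    norm_num [CRBM.F, CRBM.f, CRBM.S, pow_add]
    apply le_of_eq
    ring
  · refine CRBM.isUniversalApproximator_of_le (r := 6) (by omega) (h6 ▸ hk) (le_trans ?_ hm)
    obtain ⟨d, rfl⟩ := Nat.exists_eq_add_of_le hk
    rw [h6, Nat.add_sub_cancel_left]
    have hF : CRBM.F 6 = 512024 := by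
      have h0 : CRBM.S 0 = 0 := rfl
      norm_num [CRBM.F, CRBM.f, CRBM.S_succ, h0]
    have hn : (0 : ℝ) ≤ 2 ^ n - 1 := sub_nonneg.mpr (one_le_pow₀ one_le_two)
    have hd : (1 : ℝ) ≤ 2 ^ d := one_le_pow₀ one_le_two
    rw [hF, pow_add]
    norm_num
    nlinarith [mul_nonneg (zero_le_one.trans hd) hn]
  · refine general r hr hk (le_trans (le_of_eq ?_) hm)
    rw [CRBM.two_pow_mul_P hr, CRBM.K, pow_sub₀ _ two_ne_zero hk]
    ring
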